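/- Let $S$ be the first-order language without identity, constant symbols or function symbols, and with countably many relation symbols $X^n_i$ ($i\in\mathbb{N}$) of each arity $n\ge 0$. Let $\mathsf{V}$ be the set of valid sentences of $S$. Let $L$ be an effective first-order language, with or without identity, possibly with constant and function symbols. An $L$-theory is a consistent set of $L$-sentences that is closed under logical consequence (among $L$-sentences). A sentence $\varphi$ of $S$ is a \emph{validity} of an $L$-theory $T$ if, for every choice of an $L$-formula $\psi^n_i(y_1,\dots,y_n)$, with free variables among $y_1,\dots,y_n$, for each relation symbol $X^n_i$, the $L$-sentence obtained from $\varphi$ by replacing each atomic formula $X^n_i(t_1,\dots,t_n)$ by $\psi^n_i(t_1,\dots,t_n)$ (with bound variables renamed to avoid capture) belongs to $T$. Let $\mathsf{V}(T)$ be the set of validities of $T$. If $T$ is a decidable $L$-theory, that is, if the set of Gödel numbers of the members of $T$ is computable, then $\mathsf{V}\subsetneq\mathsf{V}(T)$. -/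

import Mathlib

universe u v

namespace TheoryValidities

open FirstOrder FirstOrder.Language

universe w

/-- The formula contains no identity symbol. -/
def IdentityFree {L : FirstOrder.Language.{u, v}} {α : Type w} :
    {n : ℕ} → L.BoundedFormula α n → Prop
  | _, .falsum => True
  | _, .equal _ _ => False
  | _, .rel _ _ => True
  | _, .imp φ ψ => IdentityFree φ ∧ IdentityFree ψ
  | _, .all φ => IdentityFree φ

/-- The formulas of the first-order language with vocabulary `L`, with identity if `identity` is
`true`, and without identity if `identity` is `false`. -/
def IsFormulaOf {L : FirstOrder.Language.{u, v}} (identity : Bool) {α : Type w} {n : ℕ}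
    (φ : L.BoundedFormula α n) : Prop :=
  identity = true ∨ IdentityFree φ

/-! ### The schematic language -/

/-- The vocabulary of the schematic language: no constant or function symbols, and countably many
relation symbols `X n i` (`i : ℕ`) of each arity `n ≥ 0`. -/
def S : FirstOrder.Language.{0, 0} where
  Functions _ := Empty
  Relations _ := ℕ

/-- The sentences of the schematic language, which has no identity. -/
def schematicSentences : Set S.Sentence :=
  {φ | IdentityFree φ}

/-- The set `V` of valid sentences of the schematic language. -/
def validSentences : Set S.Sentence :=
  {φ | φ ∈ schematicSentences ∧ (∅ : S.Theory) ⊨ᵇ φ}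

/-! ### Substitution instances -/

/-- Every term of the schematic language is a variable. -/
def termVar {β : Type w} : S.Term β → β
  | .var x => x
  | .func f _ => Empty.elim f

/-- A choice of an `L`-formula `ψ n X`, with free variables among `y 0, …, y (n - 1)`, for each
schematic relation symbol `X` of arity `n`. -/
abbrev Assignment (L : FirstOrder.Language.{u, v}) : Type (max u v) :=
  (n : ℕ) → S.Relations n → L.Formula (Fin n)

/-- The result of replacing each atomic formula `X (t 1, …, t n)` by `ψ n X (t 1, …, t n)`.
Bound variables are de Bruijn levels; `relabel` puts the variables `t j` for the free variables of
`ψ n X`, and moves the bound variables of `ψ n X` out of their way. The clause for identity is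
never used, as schematic formulas have no identity. -/
def substInstance {L : FirstOrder.Language.{u, v}} (ψ : Assignment L) :
    {k : ℕ} → S.BoundedFormula Empty k → L.BoundedFormula Empty k
  | _, .falsum => .falsum
  | _, .equal t₁ t₂ => .equal (.var (termVar t₁)) (.var (termVar t₂))
  | _, .rel (l := n) X ts => BoundedFormula.relabel (fun j => termVar (ts j)) (ψ n X)
  | _, .imp φ₁ φ₂ => .imp (substInstance ψ φ₁) (substInstance ψ φ₂)
  | _, .all φ => .all (substInstance ψ φ)

/-! ### Theories and their validities -/

/-- A theory of the language with vocabulary `L` (with or without identity): a consistent set of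
sentences of that language, closed under logical consequence. -/
structure IsTheory {L : FirstOrder.Language.{u, v}} (identity : Bool) (T : Set L.Sentence) : Prop where
  sentences : ∀ φ ∈ T, IsFormulaOf identity φ
  closed : ∀ φ : L.Sentence, IsFormulaOf identity φ → Theory.ModelsBoundedFormula T φ → φ ∈ T
  consistent : Theory.IsSatisfiable T

/-- The set `V(T)` of the validities of `T`: the schematic sentences all of whose substitution
instances in the language of `T` belong to `T`. -/
def validities {L : FirstOrder.Language.{u, v}} (identity : Bool) (T : Set L.Sentence) : Set S.Sentence :=
  {φ | φ ∈ schematicSentences ∧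
    ∀ ψ : Assignment L, (∀ n X, IsFormulaOf identity (ψ n X)) → substInstance ψ φ ∈ T}

/-! ### Effective languages and decidable theories -/

/-- An effective numbering of the vocabulary `L`: function symbols (constants are those of arity
`0`) and relation symbols have numbers, and it is decidable whether a number is the number of a
symbol, and of which arity. -/
structure EffectiveVocabulary (L : FirstOrder.Language.{u, v}) where
  funCode : {n : ℕ} → L.Functions n → ℕ
  relCode : {n : ℕ} → L.Relations n → ℕ
  funCode_injective : ∀ n, Function.Injective (funCode : L.Functions n → ℕ)
  relCode_injective : ∀ n, Function.Injective (relCode : L.Relations n → ℕ)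
  /-- The arity of the function symbol with the given number, if there is one. -/
  funArity : ℕ → Option ℕ
  /-- The arity of the relation symbol with the given number, if there is one. -/
  relArity : ℕ → Option ℕ
  funArity_eq_some : ∀ c n, funArity c = some n ↔ ∃ f : L.Functions n, funCode f = c
  relArity_eq_some : ∀ c n, relArity c = some n ↔ ∃ R : L.Relations n, relCode R = c
  funArity_computable : Computable funArity
  relArity_computable : Computable relArity

namespace EffectiveVocabulary

variable {L : FirstOrder.Language.{u, v}} (E : EffectiveVocabulary L)

/-- Gödel numbers of terms. -/
def termCode {β : Type w} [Encodable β] : L.Term β → ℕ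
  | .var x => Nat.pair 0 (Encodable.encode x)
  | .func f ts =>
      Nat.pair 1 (Nat.pair (E.funCode f) (Encodable.encode (List.ofFn fun i => termCode (ts i))))

/-- Gödel numbers of formulas. -/
def formulaCode {α : Type w} [Encodable α] : {n : ℕ} → L.BoundedFormula α n → ℕ
  | _, .falsum => Nat.pair 0 0
  | _, .equal t₁ t₂ => Nat.pair 1 (Nat.pair (E.termCode t₁) (E.termCode t₂))
  | _, .rel R ts =>
      Nat.pair 2 (Nat.pair (E.relCode R) (Encodable.encode (List.ofFn fun i => E.termCode (ts i))))
  | _, .imp φ ψ => Nat.pair 3 (Nat.pair (formulaCode φ) (formulaCode ψ))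
  | _, .all φ => Nat.pair 4 (formulaCode φ)

/-- A set of sentences is decidable if the set of the Gödel numbers of its members is computable. -/
def IsDecidable (T : Set L.Sentence) : Prop :=
  ComputablePred fun c : ℕ => ∃ φ ∈ T, E.formulaCode φ = c

end EffectiveVocabulary

end TheoryValidities

/-! Every schematic structure induced on an `L`-structure by an assignment `ψ` is an ordinary
`S`-structure (`realize_substInstance`), so valid sentences are validities of `T`.

For properness, fix a code `c` whose sets `{n | c(n) = 0}` and `{n | c(n) = 1}` are recursively
inseparable (`exists_inseparable_code`). A finite list Γ = `axiomsOf c` describes enough arithmetic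
to follow the computation of `c`, and forbids the values 0 and 1 at one argument. Over Γ, the
sentence `valueSentence c n` is provable if `c(n) = 0` (`realize_valueSentence`) and refutable if
`c(n) = 1` (`not_realize_valueSentence`).

The separating sentence is "Γ implies falsum". It is not valid, because ℕ satisfies Γ. Now fix `ψ`.
The set of `n` for which `T` contains the `ψ`-instance of "Γ implies `valueSentence c n`" is
decidable and contains every `n` with `c(n) = 0`, so by inseparability it contains some `n` with
`c(n) = 1`. For that `n`, Γ also refutes `valueSentence c n`, so `T` contains the instance of "Γ
implies falsum". `T` itself need not interpret any arithmetic. -/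

namespace TheoryValidities

open FirstOrder FirstOrder.Language

/-! ### Substitution instances and induced structures -/

section Substitution

variable {L : FirstOrder.Language.{u, v}}

/-- The schematic structure that an assignment induces on an `L`-structure. -/
abbrev inducedStructure (ψ : Assignment L) (M : Type*) [L.Structure M] : S.Structure M where
  funMap f _ := Empty.elim f
  RelMap {n} X xs := (ψ n X).Realize xs

theorem realize_eq_termVar {M : Type*} [S.Structure M] {β : Type*} (t : S.Term β) (v : β → M) :
    t.realize v = v (termVar t) := by
  cases t with
  | var x => rfl
  | func f _ => exact Empty.elim f

theorem realize_substInstance (ψ : Assignment L) {M : Type*} [L.Structure M] {k : ℕ}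
    (φ : S.BoundedFormula Empty k) (v : Empty → M) (xs : Fin k → M) :
    (substInstance ψ φ).Realize v xs ↔
      @BoundedFormula.Realize S M (inducedStructure ψ M) _ _ φ v xs := by
  let := inducedStructure ψ M
  induction φ with
  | falsum => rfl
  | equal t₁ t₂ =>
    simp only [substInstance, BoundedFormula.Realize, realize_eq_termVar, Term.realize_var]
  | rel X ts =>
    simp only [substInstance, BoundedFormula.Realize, realize_eq_termVar]
    refine BoundedFormula.realize_relabel.trans ?_
    change _ ↔ (ψ _ X).Realize _
    -- `ψ _ X` has no outer bound variables, so its tuple of bound values is indexed by `Fin 0` and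
    -- is unique.
    exact Iff.of_eq (congrArg₂ (BoundedFormula.Realize (ψ _ X)) rfl (Subsingleton.elim _ _))
  | imp φ₁ φ₂ ih₁ ih₂ =>
    simp only [substInstance, BoundedFormula.realize_imp, ih₁, ih₂]
  | all φ ih =>
    simp only [substInstance, BoundedFormula.realize_all, ih]

theorem IdentityFree.relabel {α β : Type*} {n m : ℕ} {φ : L.BoundedFormula α m}
    (h : IdentityFree φ) (g : α → β ⊕ Fin n) : IdentityFree (φ.relabel g) := by
  induction φ with
  | falsum => trivial
  | equal => exact h.elim
  | rel => trivial
  | imp φ₁ φ₂ ih₁ ih₂ => exact ⟨ih₁ h.1, ih₂ h.2⟩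
  | all φ ih =>
    rw [BoundedFormula.relabel_all]
    exact ih h

theorem identityFree_substInstance {ψ : Assignment L} (hψ : ∀ n X, IdentityFree (ψ n X)) {k : ℕ}
    {φ : S.BoundedFormula Empty k} (h : IdentityFree φ) : IdentityFree (substInstance ψ φ) := by
  induction φ with
  | falsum => trivial
  | equal => exact h.elim
  | rel X ts => exact (hψ _ X).relabel _
  | imp φ₁ φ₂ ih₁ ih₂ => exact ⟨ih₁ h.1, ih₂ h.2⟩
  | all φ ih => exact ih h

theorem isFormulaOf_substInstance {identity : Bool} {ψ : Assignment L}
    (hψ : ∀ n X, IsFormulaOf identity (ψ n X)) {k : ℕ} {φ : S.BoundedFormula Empty k}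
    (h : IdentityFree φ) : IsFormulaOf identity (substInstance ψ φ) := by
  by_cases hi : identity = true
  · exact Or.inl hi
  · exact Or.inr (identityFree_substInstance (fun n X => (hψ n X).resolve_left hi) h)

/-- An instance of a schematic sentence belongs to a theory if the sentence holds in all the
schematic structures induced on the models of the theory. -/
theorem IsTheory.substInstance_mem {identity : Bool} {T : Set L.Sentence}
    (hT : IsTheory identity T) {ψ : Assignment L} (hψ : ∀ n X, IsFormulaOf identity (ψ n X))
    {φ : S.Sentence} (hφ : IdentityFree φ)
    (h : ∀ (M : Type (max u v)) [L.Structure M] [Nonempty M], M ⊨ (T : L.Theory) →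
      @Sentence.Realize S M (inducedStructure ψ M) φ) : substInstance ψ φ ∈ T := by
  refine hT.closed _ (isFormulaOf_substInstance hψ hφ) fun M v xs => ?_
  rw [realize_substInstance, Subsingleton.elim v default, Subsingleton.elim xs default]
  exact h M M.is_model

theorem realize_of_substInstance_mem {T : Set L.Sentence} {ψ : Assignment L} {φ : S.Sentence}
    (h : substInstance ψ φ ∈ T) {M : Type*} [L.Structure M] (hM : M ⊨ (T : L.Theory)) :
    @Sentence.Realize S M (inducedStructure ψ M) φ :=
  (realize_substInstance ψ φ default default).1 (hM.realize_of_mem _ h)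

theorem validSentences_subset_validities {identity : Bool} {T : Set L.Sentence}
    (hT : IsTheory identity T) : validSentences ⊆ validities identity T := by
  refine fun φ hφ => ⟨hφ.1, fun ψ hψ => hT.substInstance_mem hψ hφ.1 fun M _ _ _ => ?_⟩
  let := inducedStructure ψ M
  -- Validity quantifies over models in one fixed universe; `realize_sentence` carries it to the
  -- universe of `M`.
  exact hφ.2.realize_sentence M

end Substitution

/-! ### Gödel numbers: injectivity and dependence on variables -/

namespace EffectiveVocabulary

variable {L : FirstOrder.Language.{u, v}} (E : EffectiveVocabulary L)

/-- Numberings are assumed injective only within each arity; symbols of different arities are kept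
apart because `relArity` is single-valued. -/
theorem relCode_arity {l m : ℕ} (R : L.Relations l) (R' : L.Relations m)
    (h : E.relCode R = E.relCode R') : l = m :=
  Option.some_injective _ (((E.relArity_eq_some _ l).2 ⟨R, rfl⟩).symm.trans
    ((E.relArity_eq_some _ m).2 ⟨R', h.symm⟩))

theorem funCode_arity {l m : ℕ} (f : L.Functions l) (f' : L.Functions m)
    (h : E.funCode f = E.funCode f') : l = m :=
  Option.some_injective _ (((E.funArity_eq_some _ l).2 ⟨f, rfl⟩).symm.trans
    ((E.funArity_eq_some _ m).2 ⟨f', h.symm⟩))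

theorem termCode_injective {β : Type*} [Encodable β] :
    Function.Injective (E.termCode : L.Term β → ℕ) := by
  intro t
  induction t with
  | var x =>
    rintro (y | _) h
    · simpa [termCode] using h
    · simp [termCode] at h
  | func f ts ih =>
    rintro (y | ⟨f', ts'⟩) h
    · simp [termCode] at h
    · simp only [termCode, Nat.pair_eq_pair, true_and, Encodable.encode_inj] at h
      obtain rfl := E.funCode_arity _ _ h.1
      obtain rfl := E.funCode_injective _ h.1
      congr
      funext i
      exact ih i (congrFun (List.ofFn_injective h.2) i)

theorem formulaCode_injective {α : Type*} [Encodable α] {n : ℕ} :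
    Function.Injective (E.formulaCode : L.BoundedFormula α n → ℕ) := by
  intro φ
  induction φ with
  | falsum => intro φ' h; cases φ' <;> simp [formulaCode] at h ⊢
  | equal t₁ t₂ =>
    intro φ' h
    cases φ' <;> simp [formulaCode] at h ⊢
    exact ⟨E.termCode_injective h.1, E.termCode_injective h.2⟩
  | rel R ts =>
    intro φ' h
    cases φ' with
    | rel R' ts' =>
      simp only [formulaCode, Nat.pair_eq_pair, true_and, Encodable.encode_inj] at h
      obtain rfl := E.relCode_arity _ _ h.1
      obtain rfl := E.relCode_injective _ h.1
      congr
      funext i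
      exact E.termCode_injective (congrFun (List.ofFn_injective h.2) i)
    | _ => simp [formulaCode] at h
  | imp φ₁ φ₂ ih₁ ih₂ =>
    intro φ' h
    cases φ' <;> simp [formulaCode] at h ⊢
    exact ⟨ih₁ h.1, ih₂ h.2⟩
  | all φ ih =>
    intro φ' h
    cases φ' <;> simp [formulaCode] at h ⊢
    exact ih h

theorem mem_iff_exists_formulaCode {T : Set L.Sentence} {φ : L.Sentence} :
    (∃ φ' ∈ T, E.formulaCode φ' = E.formulaCode φ) ↔ φ ∈ T :=
  ⟨fun ⟨_, h, e⟩ => E.formulaCode_injective e ▸ h, fun h => ⟨φ, h, rfl⟩⟩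

theorem primrec_encode_ofFn {n : ℕ} {f : Fin n → ℕ → ℕ} (hf : ∀ i, Primrec (f i)) :
    Primrec fun a => Encodable.encode (List.ofFn fun i => f i a) :=
  Primrec.encode.comp (Primrec.list_ofFn hf)

/-- The Gödel number of a fixed term depends primitive recursively on a renaming of its
variables. -/
theorem primrec_termCode_relabel {β : Type*} {γ : ℕ → Type*} [∀ a, Encodable (γ a)]
    (t : L.Term β) (g : ∀ a, β → γ a) (hg : ∀ x, Primrec fun a => Encodable.encode (g a x)) :
    Primrec fun a => E.termCode (t.relabel (g a)) := by
  induction t with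
  | var x => exact Primrec₂.natPair.comp (Primrec.const 0) (hg x)
  | func f ts ih =>
    exact Primrec₂.natPair.comp (Primrec.const 1)
      (Primrec₂.natPair.comp (Primrec.const _) (primrec_encode_ofFn ih))

/-- Former free variables keep their new level, while former bound variables are shifted up by `d
a`. The codes are thus given or affine in `d a`. -/
theorem primrec_encode_relabelAux {α : Type*} {d : ℕ → ℕ} (hd : Primrec d)
    (g : ∀ a, α → Empty ⊕ Fin (d a)) (hg : ∀ x, Primrec fun a => Encodable.encode (g a x)) {k : ℕ}
    (x : α ⊕ Fin k) :
    Primrec fun a => Encodable.encode (BoundedFormula.relabelAux (g a) k x) := by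
  rcases x with x | i
  · refine (hg x).of_eq fun a => ?_
    rcases h : g a x with e | j
    · exact e.elim
    · simp only [BoundedFormula.relabelAux, h, Encodable.encode_inr, Function.comp_apply,
        Sum.map_inl, Equiv.sumAssoc_apply_inl_inr, Sum.map_inr, finSumFinEquiv_apply_left]
      rfl
  -- The encoding of a sum sends `inr i` to `2 * i + 1`.
  · refine (Primrec.nat_add.comp (Primrec.nat_mul.comp (Primrec.const 2)
      (Primrec.nat_add.comp hd (Primrec.const (i : ℕ)))) (Primrec.const 1)).of_eq fun a => ?_
    simp only [BoundedFormula.relabelAux, Encodable.encode_inr, Function.comp_apply, id_eq,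
      Sum.map_inr, Equiv.sumAssoc_apply_inr, finSumFinEquiv_apply_right]
    rfl

/-- The Gödel number of a fixed formula depends primitive recursively on a renaming of its free
variables to bound variables. -/
theorem primrec_formulaCode_relabel {α : Type*} {d : ℕ → ℕ} (hd : Primrec d)
    (g : ∀ a, α → Empty ⊕ Fin (d a)) (hg : ∀ x, Primrec fun a => Encodable.encode (g a x)) {k : ℕ}
    (φ : L.BoundedFormula α k) : Primrec fun a => E.formulaCode (φ.relabel (g a)) := by
  have ht : ∀ {k : ℕ} (t : L.Term (α ⊕ Fin k)),
      Primrec fun a => E.termCode (t.relabel (BoundedFormula.relabelAux (g a) k)) := fun t =>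
    E.primrec_termCode_relabel t _ (primrec_encode_relabelAux hd g hg)
  induction φ with
  | falsum => exact Primrec.const _
  | equal t₁ t₂ =>
    exact Primrec₂.natPair.comp (Primrec.const 1) (Primrec₂.natPair.comp (ht t₁) (ht t₂))
  | rel R ts =>
    exact Primrec₂.natPair.comp (Primrec.const 2)
      (Primrec₂.natPair.comp (Primrec.const _) (primrec_encode_ofFn fun i => ht (ts i)))
  | imp φ₁ φ₂ ih₁ ih₂ =>
    exact Primrec₂.natPair.comp (Primrec.const 3) (Primrec₂.natPair.comp ih₁ ih₂)
  | all φ ih =>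
    simp only [BoundedFormula.relabel_all]
    exact Primrec₂.natPair.comp (Primrec.const 4) ih

end EffectiveVocabulary

/-! ### The axioms Γ and their standard structure -/

section Axioms

open BoundedFormula Nat.Partrec

/-- The atomic formula `X (x (v 0), …, x (v (n - 1)))`. -/
def atom {n k : ℕ} (X : ℕ) (v : Fin n → Fin k) : S.BoundedFormula Empty k :=
  .rel (l := n) (show S.Relations n from X) fun j => .var (.inr (v j))

/-- The formula saying that `x` is zero. -/
def zeroAt {k : ℕ} (x : Fin k) : S.BoundedFormula Empty k := atom 0 ![x]

/-- The formula saying that `y` is the successor of `x`. -/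
def succAt {k : ℕ} (x y : Fin k) : S.BoundedFormula Empty k := atom 0 ![x, y]

/-- The formula saying that the code `c` maps `x` to `y`. -/
def evalAt {k : ℕ} (c : Code) (x y : Fin k) : S.BoundedFormula Empty k :=
  -- The shift by one keeps the binary symbol with index 0 free for `succAt`.
  atom (Encodable.encode c + 1) ![x, y]

/-- The formula saying that `z` is the sum of `x` and `y`. -/
def addAt {k : ℕ} (x y z : Fin k) : S.BoundedFormula Empty k := atom 0 ![x, y, z]

/-- The formula saying that `z` is the product of `x` and `y`. -/
def mulAt {k : ℕ} (x y z : Fin k) : S.BoundedFormula Empty k := atom 1 ![x, y, z]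

/-- The formula saying that `z` is the code of the pair of `x` and `y`. -/
def pairAt {k : ℕ} (x y z : Fin k) : S.BoundedFormula Empty k := atom 2 ![x, y, z]

section Relations

variable {M : Type*} [S.Structure M]

/-- The interpretation of `zeroAt`. -/
def IsZero (x : M) : Prop :=
  Structure.RelMap (L := S) (n := 1) (show S.Relations 1 from (0 : ℕ)) ![x]

/-- The interpretation of `succAt`. -/
def IsSucc (x y : M) : Prop :=
  Structure.RelMap (L := S) (n := 2) (show S.Relations 2 from (0 : ℕ)) ![x, y]

/-- The interpretation of `evalAt`. -/
def IsEval (c : Code) (x y : M) : Prop :=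
  Structure.RelMap (L := S) (n := 2) (show S.Relations 2 from Encodable.encode c + 1) ![x, y]

/-- The interpretation of `addAt`. -/
def IsAdd (x y z : M) : Prop :=
  Structure.RelMap (L := S) (n := 3) (show S.Relations 3 from (0 : ℕ)) ![x, y, z]

/-- The interpretation of `mulAt`. -/
def IsMul (x y z : M) : Prop :=
  Structure.RelMap (L := S) (n := 3) (show S.Relations 3 from (1 : ℕ)) ![x, y, z]

/-- The interpretation of `pairAt`. -/
def IsPair (x y z : M) : Prop :=
  Structure.RelMap (L := S) (n := 3) (show S.Relations 3 from (2 : ℕ)) ![x, y, z]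

variable {k : ℕ} (v : Empty → M) (xs : Fin k → M)

theorem realize_zeroAt (x : Fin k) : (zeroAt x).Realize v xs ↔ IsZero (xs x) :=
  Iff.of_eq (congrArg _ (FinVec.map_eq xs ![x]).symm)

theorem realize_succAt (x y : Fin k) : (succAt x y).Realize v xs ↔ IsSucc (xs x) (xs y) :=
  Iff.of_eq (congrArg _ (FinVec.map_eq xs ![x, y]).symm)

theorem realize_evalAt (c : Code) (x y : Fin k) :
    (evalAt c x y).Realize v xs ↔ IsEval c (xs x) (xs y) :=
  Iff.of_eq (congrArg _ (FinVec.map_eq xs ![x, y]).symm)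

theorem realize_addAt (x y z : Fin k) :
    (addAt x y z).Realize v xs ↔ IsAdd (xs x) (xs y) (xs z) :=
  Iff.of_eq (congrArg _ (FinVec.map_eq xs ![x, y, z]).symm)

theorem realize_mulAt (x y z : Fin k) :
    (mulAt x y z).Realize v xs ↔ IsMul (xs x) (xs y) (xs z) :=
  Iff.of_eq (congrArg _ (FinVec.map_eq xs ![x, y, z]).symm)

theorem realize_pairAt (x y z : Fin k) :
    (pairAt x y z).Realize v xs ↔ IsPair (xs x) (xs y) (xs z) :=
  Iff.of_eq (congrArg _ (FinVec.map_eq xs ![x, y, z]).symm)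

theorem sentence_realize_alls (φ : S.BoundedFormula Empty k) :
    M ⊨ φ.alls ↔ ∀ xs : Fin k → M, φ.Realize default xs :=
  realize_alls

theorem sentence_realize_ex (φ : S.BoundedFormula Empty 1) :
    Sentence.Realize M φ.ex ↔ ∃ x : M, φ.Realize default (Fin.snoc default x) :=
  realize_ex

end Relations

/-- Axioms for zero, successor, addition, multiplication and pairing. -/
def arithmeticAxioms : List S.Sentence :=
  [ (zeroAt (0 : Fin 1)).ex,
    (succAt (0 : Fin 2) 1).ex.alls,
    -- Without identity a number may have many representatives, and `x + 0 = x` would give the sum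
    -- only at `x` itself. Starting from three arbitrary zeros and recursing in both summands
    -- reaches all representatives.
    (zeroAt (0 : Fin 3) ⟹ zeroAt 1 ⟹ zeroAt 2 ⟹ addAt 0 1 2).alls,
    (addAt (0 : Fin 5) 1 2 ⟹ succAt 0 3 ⟹ succAt 2 4 ⟹ addAt 3 1 4).alls,
    (addAt (0 : Fin 5) 1 2 ⟹ succAt 1 3 ⟹ succAt 2 4 ⟹ addAt 0 3 4).alls,
    (zeroAt (1 : Fin 3) ⟹ zeroAt 2 ⟹ mulAt 0 1 2).alls,
    (mulAt (0 : Fin 5) 1 2 ⟹ succAt 1 3 ⟹ addAt 2 0 4 ⟹ mulAt 0 3 4).alls,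
    -- `Nat.pair a b` is `b * b + a` if `a < b`, and `a * a + a + b` otherwise. The case is
    -- expressed positively, by a difference `b = a + (d + 1)` or `a = b + d`.
    (succAt (0 : Fin 6) 1 ⟹ addAt 2 1 3 ⟹ mulAt 3 3 4 ⟹ addAt 4 2 5 ⟹ pairAt 2 3 5).alls,
    (addAt (1 : Fin 6) 0 2 ⟹ mulAt 2 2 3 ⟹ addAt 3 2 4 ⟹ addAt 4 1 5 ⟹ pairAt 2 1 5).alls ]

/-- Axioms for the graph of the partial function computed by a code. -/
def codeAxioms : Code → List S.Sentence
  | .zero => [(zeroAt (1 : Fin 2) ⟹ evalAt .zero 0 1).alls]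
  -- `addAt` with a representative of one replaces `succAt`: a given representative of `n + 1` need
  -- not be a successor of the given representative of `n`.
  | .succ => [(zeroAt (1 : Fin 4) ⟹ succAt 1 2 ⟹ addAt 0 2 3 ⟹ evalAt .succ 0 3).alls]
  | .left => [(pairAt (0 : Fin 3) 1 2 ⟹ evalAt .left 2 0).alls]
  | .right => [(pairAt (0 : Fin 3) 1 2 ⟹ evalAt .right 2 1).alls]
  | .pair f g => codeAxioms f ++ codeAxioms g ++
      [(evalAt f (0 : Fin 4) 1 ⟹ evalAt g 0 2 ⟹ pairAt 1 2 3 ⟹ evalAt (.pair f g) 0 3).alls]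
  | .comp f g => codeAxioms f ++ codeAxioms g ++
      [(evalAt g (0 : Fin 3) 1 ⟹ evalAt f 1 2 ⟹ evalAt (.comp f g) 0 2).alls]
  | .prec f g => codeAxioms f ++ codeAxioms g ++
      [(zeroAt (1 : Fin 4) ⟹ pairAt 0 1 2 ⟹ evalAt f 0 3 ⟹ evalAt (.prec f g) 2 3).alls,
        (succAt (1 : Fin 9) 2 ⟹ pairAt 0 1 3 ⟹ pairAt 0 2 4 ⟹ evalAt (.prec f g) 3 5 ⟹
          pairAt 1 5 6 ⟹ pairAt 0 6 7 ⟹ evalAt g 7 8 ⟹ evalAt (.prec f g) 4 8).alls]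
  | .rfind' f => codeAxioms f ++
      -- At `(a, k)`, `rfind'` searches upwards from `k`: it stops at `k` if `f` is zero there, and
      -- otherwise agrees with the search from `k + 1`.
      [(pairAt (0 : Fin 4) 1 2 ⟹ zeroAt 3 ⟹ evalAt f 2 3 ⟹ evalAt (.rfind' f) 2 1).alls,
        (pairAt (0 : Fin 8) 1 2 ⟹ succAt 3 4 ⟹ evalAt f 2 4 ⟹ succAt 1 5 ⟹ pairAt 0 5 6 ⟹
          evalAt (.rfind' f) 6 7 ⟹ evalAt (.rfind' f) 2 7).alls]

/-- The axiom saying that the code `c` does not take both values zero and one at any argument. -/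
def exclusionAxiom (c : Code) : S.Sentence :=
  (zeroAt (1 : Fin 3) ⟹ succAt 1 2 ⟹ evalAt c 0 1 ⟹ evalAt c 0 2 ⟹ .falsum).alls

theorem identityFree_alls {n : ℕ} {φ : S.BoundedFormula Empty n} (h : IdentityFree φ) :
    IdentityFree φ.alls := by
  induction n with
  | zero => exact h
  | succ n ih => exact ih (φ := φ.all) h

theorem identityFree_ex {n : ℕ} {φ : S.BoundedFormula Empty (n + 1)} (h : IdentityFree φ) :
    IdentityFree φ.ex :=
  ⟨⟨h, trivial⟩, trivial⟩

theorem identityFree_arithmeticAxioms : ∀ γ ∈ arithmeticAxioms, IdentityFree γ := by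
  simp only [arithmeticAxioms, List.forall_mem_cons]
  refine ⟨identityFree_ex trivial, identityFree_alls (identityFree_ex trivial), ?_, ?_, ?_, ?_, ?_,
    ?_, ?_, by simp⟩ <;> exact identityFree_alls (by repeat constructor)

theorem identityFree_codeAxioms (c : Code) : ∀ γ ∈ codeAxioms c, IdentityFree γ := by
  induction c <;> simp only [codeAxioms, List.forall_mem_append, List.forall_mem_cons]
  all_goals repeat' first
    | assumption
    | exact List.forall_mem_nil _
    | exact True.intro
    | refine identityFree_alls ?_
    | apply And.intro

theorem identityFree_exclusionAxiom (c : Code) : IdentityFree (exclusionAxiom c) :=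
  identityFree_alls (by repeat constructor)

/-- The schematic structure on the natural numbers in which the symbols of the axioms have their
intended meaning. -/
def standardRel : (n : ℕ) → ℕ → (Fin n → ℕ) → Prop
  | 1, _, x => x 0 = 0
  | 2, 0, x => x 1 = x 0 + 1
  | 2, i + 1, x => x 1 ∈ (Denumerable.ofNat Code i).eval (x 0)
  | 3, 0, x => x 0 + x 1 = x 2
  | 3, 1, x => x 0 * x 1 = x 2
  | 3, 2, x => Nat.pair (x 0) (x 1) = x 2
  | _, _, _ => True

/-- The natural numbers as a schematic structure. -/
abbrev standardStructure : S.Structure ℕ where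
  funMap f _ := Empty.elim f
  RelMap {n} X x := standardRel n X x

section Standard

attribute [local instance] standardStructure

theorem isZero_iff {x : ℕ} : IsZero x ↔ x = 0 := Iff.rfl

theorem isSucc_iff {x y : ℕ} : IsSucc x y ↔ y = x + 1 := Iff.rfl

theorem isAdd_iff {x y z : ℕ} : IsAdd x y z ↔ x + y = z := Iff.rfl

theorem isMul_iff {x y z : ℕ} : IsMul x y z ↔ x * y = z := Iff.rfl

theorem isPair_iff {x y z : ℕ} : IsPair x y z ↔ Nat.pair x y = z := Iff.rfl

theorem isEval_iff {c : Code} {x y : ℕ} : IsEval c x y ↔ y ∈ c.eval x := by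
  change y ∈ (Denumerable.ofNat Code (Encodable.encode c)).eval x ↔ _
  rw [Denumerable.ofNat_encode]

end Standard

end Axioms

/-! ### Computations in ℕ and in arbitrary models of the axioms -/

section Models

open BoundedFormula Nat.Partrec

theorem Code.mem_eval_pair {f g : Code} {n m : ℕ} :
    m ∈ (Code.pair f g).eval n ↔ ∃ a ∈ f.eval n, ∃ b ∈ g.eval n, Nat.pair a b = m := by
  simp [Code.eval, Seq.seq]

theorem Code.mem_eval_comp {f g : Code} {n m : ℕ} :
    m ∈ (Code.comp f g).eval n ↔ ∃ a ∈ g.eval n, m ∈ f.eval a :=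
  Part.mem_bind_iff

theorem Code.mem_eval_prec_succ {f g : Code} {a k m : ℕ} :
    m ∈ (Code.prec f g).eval (Nat.pair a (k + 1)) ↔
      ∃ i ∈ (Code.prec f g).eval (Nat.pair a k), m ∈ g.eval (Nat.pair a (Nat.pair k i)) := by
  rw [Code.eval_prec_succ]
  simp

theorem Code.mem_eval_rfind' {f : Code} {a k m : ℕ} :
    m ∈ (Code.rfind' f).eval (Nat.pair a k) ↔
      ∃ j, m = j + k ∧ 0 ∈ f.eval (Nat.pair a (j + k)) ∧
        ∀ i < j, ∃ y, y + 1 ∈ f.eval (Nat.pair a (i + k)) := by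
  -- `Nat.rfind` tests a boolean; `true` means the value zero, and `false` a defined value that is a
  -- successor.
  have hd : ∀ (y : ℕ) (b : Bool), (∃ z ∈ f.eval y, decide (z = 0) = b) ↔
      if b then 0 ∈ f.eval y else ∃ z, z + 1 ∈ f.eval y := by
    rintro y (_ | _)
    · simp only [decide_eq_false_iff_not, Bool.false_eq_true, if_false]
      exact ⟨fun ⟨z, hz, h0⟩ => ⟨z - 1, by rwa [Nat.sub_add_cancel (Nat.pos_of_ne_zero h0)]⟩,
        fun ⟨z, hz⟩ => ⟨_, hz, by simp⟩⟩
    · simp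
  simp only [Code.eval, Nat.unpaired, Nat.unpair_pair, Part.mem_map_iff, Part.map_eq_map, hd,
    @Nat.mem_rfind (fun n => Part.map (fun m => decide (m = 0)) (f.eval (Nat.pair a (n + k))))]
  simp only [if_true, Bool.false_eq_true, if_false]
  exact ⟨fun ⟨j, ⟨h, h'⟩, e⟩ => ⟨j, e.symm, h, fun i hi => h' hi⟩,
    fun ⟨j, e, h, h'⟩ => ⟨j, ⟨h, fun {i} hi => h' i hi⟩, e.symm⟩⟩

theorem Code.mem_eval_rfind'_of_zero {f : Code} {a k : ℕ} (h : 0 ∈ f.eval (Nat.pair a k)) :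
    k ∈ (Code.rfind' f).eval (Nat.pair a k) :=
  Code.mem_eval_rfind'.2 ⟨0, by simpa using h⟩

theorem Code.mem_eval_rfind'_of_succ {f : Code} {a k y m : ℕ}
    (h : y + 1 ∈ f.eval (Nat.pair a k)) (hm : m ∈ (Code.rfind' f).eval (Nat.pair a (k + 1))) :
    m ∈ (Code.rfind' f).eval (Nat.pair a k) := by
  obtain ⟨j, rfl, hz, hlt⟩ := Code.mem_eval_rfind'.1 hm
  refine Code.mem_eval_rfind'.2 ⟨j + 1, by omega, ?_, fun i hi => ?_⟩
  · rwa [add_right_comm, add_assoc]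
  · rcases i with _ | i
    · exact ⟨y, by simpa using h⟩
    · rw [add_right_comm, add_assoc]
      exact hlt i (by omega)

section Standard

attribute [local instance] standardStructure

theorem realize_arithmeticAxioms_standard : ∀ γ ∈ arithmeticAxioms, ℕ ⊨ γ := by
  simp only [arithmeticAxioms, List.forall_mem_cons, sentence_realize_alls, realize_imp,
    realize_zeroAt, realize_succAt, realize_addAt, realize_mulAt,
    realize_pairAt, realize_ex, sentence_realize_ex, isZero_iff, isSucc_iff, isAdd_iff,
    isMul_iff, isPair_iff]
  refine ⟨⟨0, rfl⟩, fun xs => ⟨xs 0 + 1, rfl⟩, ?_, ?_, ?_, ?_, ?_, ?_, ?_,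
    List.forall_mem_nil _⟩ <;> intro xs
  · omega
  · omega
  · omega
  · rintro h h'
    rw [h, h', mul_zero]
  · rintro h h' h''
    rw [h', ← h'', ← h, mul_add_one]
  · rintro h h' h'' h'''
    rw [Nat.pair, if_pos (by omega), h'', h''']
  · rintro h h' h'' h'''
    rw [Nat.pair, if_neg (by omega), h', h'', h''']

theorem realize_codeAxioms_standard (c : Code) : ∀ γ ∈ codeAxioms c, ℕ ⊨ γ := by
  induction c <;> simp only [codeAxioms, List.forall_mem_append, List.forall_mem_cons,
    sentence_realize_alls, realize_imp, realize_zeroAt, realize_succAt, realize_addAt,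
    realize_pairAt, realize_evalAt,
    isZero_iff, isSucc_iff, isAdd_iff, isPair_iff, isEval_iff]
  case zero => exact ⟨fun xs h => h ▸ Part.mem_some 0, List.forall_mem_nil _⟩
  case succ => exact ⟨fun xs h h' h'' => by simp [← h'', h', h, Code.eval], List.forall_mem_nil _⟩
  case left => exact ⟨fun xs h => by simp [← h, Code.eval], List.forall_mem_nil _⟩
  case right => exact ⟨fun xs h => by simp [← h, Code.eval], List.forall_mem_nil _⟩
  case pair f g ihf ihg =>
    exact ⟨⟨ihf, ihg⟩, fun xs h₁ h₂ h₃ => Code.mem_eval_pair.2 ⟨_, h₁, _, h₂, h₃⟩,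
      List.forall_mem_nil _⟩
  case comp f g ihf ihg =>
    exact ⟨⟨ihf, ihg⟩, fun xs h₁ h₂ => Code.mem_eval_comp.2 ⟨_, h₁, h₂⟩, List.forall_mem_nil _⟩
  case prec f g ihf ihg =>
    refine ⟨⟨ihf, ihg⟩, fun xs h₁ h₂ h₃ => ?_, fun xs h₁ h₂ h₃ h₄ h₅ h₆ h₇ => ?_,
      List.forall_mem_nil _⟩
    · rwa [← h₂, h₁, Code.eval_prec_zero]
    · rw [← h₃, h₁, Code.mem_eval_prec_succ]
      exact ⟨_, h₂ ▸ h₄, by rwa [h₅, h₆]⟩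
  case rfind' f ih =>
    refine ⟨ih, fun xs h₁ h₂ h₃ => ?_, fun xs h₁ h₂ h₃ h₄ h₅ h₆ => ?_, List.forall_mem_nil _⟩
    · rw [← h₁]
      exact Code.mem_eval_rfind'_of_zero (by rwa [h₁, ← h₂])
    · rw [← h₁]
      exact Code.mem_eval_rfind'_of_succ (by rwa [h₁, ← h₂]) (by rwa [← h₄, h₅])

theorem realize_exclusionAxiom_standard (c : Code) : ℕ ⊨ exclusionAxiom c := by
  simp only [exclusionAxiom, sentence_realize_alls, realize_imp,
    realize_zeroAt, realize_succAt, realize_evalAt, isZero_iff, isSucc_iff, isEval_iff]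
  intro xs h₀ h₁ h₂ h₃
  have := Part.mem_unique h₂ h₃
  omega

end Standard

variable {M : Type*} [S.Structure M]

/-- The element `x` is an `n`-th successor of a zero. -/
def Represents : ℕ → M → Prop
  | 0, x => IsZero x
  | n + 1, x => ∃ y, Represents n y ∧ IsSucc y x

theorem exists_isZero (hM : ∀ γ ∈ arithmeticAxioms, M ⊨ γ) : ∃ x : M, IsZero x := by
  have h := hM (zeroAt (0 : Fin 1)).ex (by simp [arithmeticAxioms])
  simp only [sentence_realize_ex, realize_zeroAt] at h
  exact h

theorem exists_isSucc (hM : ∀ γ ∈ arithmeticAxioms, M ⊨ γ) (x : M) : ∃ y : M, IsSucc x y := by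
  have h := hM (succAt (0 : Fin 2) 1).ex.alls (by simp [arithmeticAxioms])
  simp only [realize_ex, sentence_realize_alls, realize_succAt] at h
  exact h ![x]

theorem exists_represents (hM : ∀ γ ∈ arithmeticAxioms, M ⊨ γ) (n : ℕ) :
    ∃ x : M, Represents n x := by
  induction n with
  | zero => exact exists_isZero hM
  | succ n ih =>
    obtain ⟨x, hx⟩ := ih
    obtain ⟨y, hy⟩ := exists_isSucc hM x
    exact ⟨y, x, hx, hy⟩

/-- Induction on `b`, with an induction on `a` inside its base case, because the only initial clause
is for `0 + 0`. -/
theorem isAdd_of_represents (hM : ∀ γ ∈ arithmeticAxioms, M ⊨ γ) {a b : ℕ} {x y z : M}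
    (hx : Represents a x) (hy : Represents b y) (hz : Represents (a + b) z) : IsAdd x y z := by
  simp only [arithmeticAxioms, List.forall_mem_cons, sentence_realize_alls, realize_imp,
    realize_zeroAt, realize_succAt, realize_addAt] at hM
  obtain ⟨-, -, h₀, h₁, h₂, -⟩ := hM
  induction b generalizing y z with
  | zero =>
    induction a generalizing x z with
    | zero => exact h₀ ![x, y, z] hx hy hz
    | succ a ih =>
      obtain ⟨x', hx', hxx⟩ := hx
      obtain ⟨z', hz', hzz⟩ := hz
      exact h₁ ![x', y, z', x, z] (ih hx' hz') hxx hzz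
  | succ b ih =>
    obtain ⟨y', hy', hyy⟩ := hy
    obtain ⟨z', hz', hzz⟩ := hz
    exact h₂ ![x, y', z', y, z] (ih hy' hz') hyy hzz

theorem isMul_of_represents (hM : ∀ γ ∈ arithmeticAxioms, M ⊨ γ) {a b : ℕ} {x y z : M}
    (hx : Represents a x) (hy : Represents b y) (hz : Represents (a * b) z) : IsMul x y z := by
  have hM' := hM
  simp only [arithmeticAxioms, List.forall_mem_cons, sentence_realize_alls, realize_imp,
    realize_zeroAt, realize_succAt, realize_addAt, realize_mulAt] at hM'
  obtain ⟨-, -, -, -, -, h₀, h₁, -⟩ := hM'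
  induction b generalizing y z with
  | zero => exact h₀ ![x, y, z] hy hz
  | succ b ih =>
    obtain ⟨y', hy', hyy⟩ := hy
    obtain ⟨w, hw⟩ := exists_represents hM (a * b)
    exact h₁ ![x, y', w, y, z] (ih hy' hw) hyy (isAdd_of_represents hM hw hx hz)

theorem isPair_of_represents (hM : ∀ γ ∈ arithmeticAxioms, M ⊨ γ) {a b : ℕ} {x y z : M}
    (hx : Represents a x) (hy : Represents b y) (hz : Represents (Nat.pair a b) z) :
    IsPair x y z := by
  have hM' := hM
  simp only [arithmeticAxioms, List.forall_mem_cons, sentence_realize_alls, realize_imp,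
    realize_zeroAt, realize_succAt, realize_addAt, realize_mulAt,
    realize_pairAt] at hM'
  obtain ⟨-, -, -, -, -, -, -, h₀, h₁, -⟩ := hM'
  by_cases hab : a < b
  · rw [Nat.pair, if_pos hab] at hz
    obtain ⟨d, rfl⟩ := Nat.exists_eq_add_of_lt hab
    obtain ⟨u, hu⟩ := exists_represents hM d
    obtain ⟨u', hu'⟩ := exists_isSucc hM u
    obtain ⟨w, hw⟩ := exists_represents hM ((a + d + 1) * (a + d + 1))
    exact h₀ ![u, u', x, y, w, z] hu'
      (isAdd_of_represents hM (b := d + 1) hx ⟨u, hu, hu'⟩ hy)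
      (isMul_of_represents hM hy hy hw) (isAdd_of_represents hM hw hx hz)
  · rw [Nat.pair, if_neg hab] at hz
    obtain ⟨d, rfl⟩ := Nat.exists_eq_add_of_le (not_lt.1 hab)
    obtain ⟨u, hu⟩ := exists_represents hM d
    obtain ⟨w, hw⟩ := exists_represents hM ((b + d) * (b + d))
    obtain ⟨w', hw'⟩ := exists_represents hM ((b + d) * (b + d) + (b + d))
    exact h₁ ![u, y, x, w, w', z] (isAdd_of_represents hM hy hu hx)
      (isMul_of_represents hM hx hx hw) (isAdd_of_represents hM hw hx hw')
      (isAdd_of_represents hM hw' hy hz)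

/-- Each step of a halting computation is an instance of an axiom, once representatives of the
intermediate values are chosen. No converse is claimed: `IsEval` may hold of further pairs in `M`.
-/
theorem isEval_of_represents (hM : ∀ γ ∈ arithmeticAxioms, M ⊨ γ) {c : Code}
    (hc : ∀ γ ∈ codeAxioms c, M ⊨ γ) {n m : ℕ} (h : m ∈ c.eval n) {x y : M}
    (hx : Represents n x) (hy : Represents m y) : IsEval c x y := by
  induction c generalizing n m x y <;> simp only [codeAxioms, List.forall_mem_append,
    List.forall_mem_cons, sentence_realize_alls, realize_imp,
    realize_zeroAt, realize_succAt, realize_addAt, realize_pairAt, realize_evalAt] at hc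
  case zero =>
    obtain rfl : m = 0 := by simpa [Code.eval, pure, PFun.pure] using h
    exact hc.1 ![x, y] hy
  case succ =>
    obtain rfl : m = n + 1 := by simpa [Code.eval] using h
    obtain ⟨z, hz⟩ := exists_isZero hM
    obtain ⟨z', hz'⟩ := exists_isSucc hM z
    exact hc.1 ![x, z, z', y] hz hz' (isAdd_of_represents hM (b := 1) hx ⟨z, hz, hz'⟩ hy)
  case left =>
    obtain rfl : m = n.unpair.1 := by simpa [Code.eval] using h
    obtain ⟨z, hz⟩ := exists_represents hM n.unpair.2
    exact hc.1 ![y, z, x] (isPair_of_represents hM hy hz (by rwa [Nat.pair_unpair]))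
  case right =>
    obtain rfl : m = n.unpair.2 := by simpa [Code.eval] using h
    obtain ⟨z, hz⟩ := exists_represents hM n.unpair.1
    exact hc.1 ![z, y, x] (isPair_of_represents hM hz hy (by rwa [Nat.pair_unpair]))
  case pair f g ihf ihg =>
    obtain ⟨a, ha, b, hb, rfl⟩ := Code.mem_eval_pair.1 h
    obtain ⟨u, hu⟩ := exists_represents hM a
    obtain ⟨w, hw⟩ := exists_represents hM b
    exact hc.2.1 ![x, u, w, y] (ihf hc.1.1 ha hx hu) (ihg hc.1.2 hb hx hw)
      (isPair_of_represents hM hu hw hy)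
  case comp f g ihf ihg =>
    obtain ⟨a, ha, hm⟩ := Code.mem_eval_comp.1 h
    obtain ⟨u, hu⟩ := exists_represents hM a
    exact hc.2.1 ![x, u, y] (ihg hc.1.2 ha hx hu) (ihf hc.1.1 hm hu hy)
  case prec f g ihf ihg =>
    obtain ⟨a, k, rfl⟩ : ∃ a k, Nat.pair a k = n := ⟨_, _, Nat.pair_unpair n⟩
    obtain ⟨w, hw⟩ := exists_represents hM a
    induction k generalizing m x y with
    | zero =>
      rw [Code.eval_prec_zero] at h
      obtain ⟨z, hz⟩ := exists_isZero hM
      exact hc.2.1 ![w, z, x, y] hz (isPair_of_represents hM (b := 0) hw hz hx)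
        (ihf hc.1.1 h hw hy)
    | succ k ih =>
      obtain ⟨i, hi, hm⟩ := Code.mem_eval_prec_succ.1 h
      obtain ⟨p, hp⟩ := exists_represents hM k
      obtain ⟨p', hp'⟩ := exists_isSucc hM p
      obtain ⟨q, hq⟩ := exists_represents hM (Nat.pair a k)
      obtain ⟨r, hr⟩ := exists_represents hM i
      obtain ⟨s, hs⟩ := exists_represents hM (Nat.pair k i)
      obtain ⟨t, ht⟩ := exists_represents hM (Nat.pair a (Nat.pair k i))
      exact hc.2.2.1 ![w, p, p', q, x, r, s, t, y] hp' (isPair_of_represents hM hw hp hq)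
        (isPair_of_represents hM (b := k + 1) hw ⟨p, hp, hp'⟩ hx) (ih hr hi hq)
        (isPair_of_represents hM hp hr hs) (isPair_of_represents hM hw hs ht)
        (ihg hc.1.2 hm ht hy)
  case rfind' f ih =>
    obtain ⟨a, k, rfl⟩ : ∃ a k, Nat.pair a k = n := ⟨_, _, Nat.pair_unpair n⟩
    obtain ⟨w, hw⟩ := exists_represents hM a
    obtain ⟨j, rfl, hz, hlt⟩ := Code.mem_eval_rfind'.1 h
    clear h
    induction j generalizing k x with
    | zero =>
      rw [zero_add] at hz hy
      obtain ⟨z, hz'⟩ := exists_isZero hM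
      exact hc.2.1 ![w, y, x, z] (isPair_of_represents hM hw hy hx) hz'
        (ih hc.1 hz hx hz')
    | succ j ihj =>
      -- The first value tested, at `k`, is `i + 1`; what remains is a search of length `j` from `k
      -- + 1`.
      obtain ⟨i, hi⟩ := hlt 0 j.succ_pos
      rw [zero_add] at hi
      obtain ⟨p, hp⟩ := exists_represents hM k
      obtain ⟨p', hp'⟩ := exists_isSucc hM p
      obtain ⟨q, hq⟩ := exists_represents hM i
      obtain ⟨q', hq'⟩ := exists_isSucc hM q
      obtain ⟨r, hr⟩ := exists_represents hM (Nat.pair a (k + 1))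
      have e : ∀ l, l + 1 + k = l + (k + 1) := fun l => by omega
      exact hc.2.2.1 ![w, p, x, q, q', p', r, y] (isPair_of_represents hM hw hp hx) hq'
        (ih hc.1 (m := i + 1) hi hx ⟨q, hq, hq'⟩) hp'
        (isPair_of_represents hM (b := k + 1) hw ⟨p, hp, hp'⟩ hr)
        (ihj (k + 1) hr (by rwa [← e]) (by rwa [← e]) fun l hl => by
          rw [← e]
          exact hlt (l + 1) (by omega))

end Models

/-! ### Separating sentences and recursive inseparability -/

section Separation

open BoundedFormula Nat.Partrec

/-- The formula saying that the code `c` takes the value zero at the `n`-th successor of the last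
variable. -/
def valueAfter (c : Code) : ℕ → (k : ℕ) → S.BoundedFormula Empty (k + 1)
  | 0, k => (zeroAt (Fin.last (k + 1)) ⟹ evalAt c (Fin.last k).castSucc (Fin.last (k + 1))).all
  | n + 1, k => (succAt (Fin.last k).castSucc (Fin.last (k + 1)) ⟹ valueAfter c n (k + 1)).all

/-- The sentence saying that the code `c` takes the value zero at `n`. -/
def valueSentence (c : Code) (n : ℕ) : S.Sentence :=
  BoundedFormula.all (zeroAt (0 : Fin 1) ⟹ valueAfter c n 0)

theorem identityFree_valueAfter (c : Code) (n k : ℕ) : IdentityFree (valueAfter c n k) := by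
  induction n generalizing k with
  | zero => exact ⟨trivial, trivial⟩
  | succ n ih => exact ⟨trivial, ih (k + 1)⟩

theorem identityFree_valueSentence (c : Code) (n : ℕ) : IdentityFree (valueSentence c n) :=
  ⟨trivial, identityFree_valueAfter c n 0⟩

section Realize

variable {M : Type*} [S.Structure M]

theorem realize_valueAfter_zero (c : Code) (k : ℕ) (v : Empty → M) (xs : Fin (k + 1) → M) :
    (valueAfter c 0 k).Realize v xs ↔ ∀ z, IsZero z → IsEval c (xs (Fin.last k)) z := by
  simp only [valueAfter, realize_all, realize_imp, realize_zeroAt, realize_evalAt, Fin.snoc_last,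
    Fin.snoc_castSucc]

theorem realize_valueAfter_succ (c : Code) (n k : ℕ) (v : Empty → M) (xs : Fin (k + 1) → M) :
    (valueAfter c (n + 1) k).Realize v xs ↔
      ∀ y, IsSucc (xs (Fin.last k)) y → (valueAfter c n (k + 1)).Realize v (Fin.snoc xs y) := by
  simp only [valueAfter, realize_all, realize_imp, realize_succAt, Fin.snoc_last,
    Fin.snoc_castSucc]

theorem realize_valueAfter_of_forall {c : Code} {m n k : ℕ} {v : Empty → M} {xs : Fin (k + 1) → M}
    (h : ∀ y : M, Represents (m + n) y → ∀ z, IsZero z → IsEval c y z)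
    (hx : Represents m (xs (Fin.last k))) : (valueAfter c n k).Realize v xs := by
  induction n generalizing m k with
  | zero => exact (realize_valueAfter_zero c k v xs).2 (h _ hx)
  | succ n ih =>
    refine (realize_valueAfter_succ c n k v xs).2 fun y hy => ih (m := m + 1) ?_ ?_
    · rwa [add_assoc, add_comm 1]
    · rw [Fin.snoc_last]
      exact ⟨_, hx, hy⟩

/-- The universal quantifiers of `valueAfter` can be instantiated because successors exist in `M`. A
single representative is enough for the clash with `exclusionAxiom`. -/
theorem exists_of_realize_valueAfter (hM : ∀ γ ∈ arithmeticAxioms, M ⊨ γ) {c : Code} {m n k : ℕ}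
    {v : Empty → M} {xs : Fin (k + 1) → M} (h : (valueAfter c n k).Realize v xs)
    (hx : Represents m (xs (Fin.last k))) :
    ∃ y : M, Represents (m + n) y ∧ ∀ z, IsZero z → IsEval c y z := by
  induction n generalizing m k with
  | zero => exact ⟨_, hx, (realize_valueAfter_zero c k v xs).1 h⟩
  | succ n ih =>
    obtain ⟨y, hy⟩ := exists_isSucc hM (xs (Fin.last k))
    have := ih (m := m + 1) ((realize_valueAfter_succ c n k v xs).1 h y hy)
      (by rw [Fin.snoc_last]; exact ⟨_, hx, hy⟩)
    rwa [add_assoc, add_comm 1] at this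

theorem realize_valueSentence_iff (c : Code) (n : ℕ) :
    M ⊨ valueSentence c n ↔
      ∀ x : M, IsZero x → (valueAfter c n 0).Realize default (Fin.snoc default x) := by
  refine (realize_all (v := (default : Empty → M))).trans ?_
  simp only [realize_imp, realize_zeroAt]
  rfl

theorem realize_valueSentence (hM : ∀ γ ∈ arithmeticAxioms, M ⊨ γ) {c : Code}
    (hc : ∀ γ ∈ codeAxioms c, M ⊨ γ) {n : ℕ} (h : 0 ∈ c.eval n) : M ⊨ valueSentence c n := by
  refine (realize_valueSentence_iff c n).2 fun x hx => realize_valueAfter_of_forall (m := 0)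
    (fun y hy z hz => isEval_of_represents hM hc h (by rwa [zero_add] at hy) hz) ?_
  exact hx

theorem not_realize_valueSentence (hM : ∀ γ ∈ arithmeticAxioms, M ⊨ γ) {c : Code}
    (hc : ∀ γ ∈ codeAxioms c, M ⊨ γ) (he : M ⊨ exclusionAxiom c) {n : ℕ} (h : 1 ∈ c.eval n) :
    ¬ M ⊨ valueSentence c n := by
  intro hs
  obtain ⟨z, hz⟩ := exists_isZero hM
  obtain ⟨z', hz'⟩ := exists_isSucc hM z
  obtain ⟨y, hy, hy0⟩ := exists_of_realize_valueAfter hM (m := 0)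
    ((realize_valueSentence_iff c n).1 hs z hz) hz
  rw [zero_add] at hy
  simp only [exclusionAxiom, sentence_realize_alls, realize_imp, realize_zeroAt, realize_succAt,
    realize_evalAt] at he
  exact he ![y, z, z'] hz hz' (hy0 z hz) (isEval_of_represents hM hc h hy ⟨z, hz, hz'⟩)

end Realize

/-- All axioms about the code `c`. -/
def axiomsOf (c : Code) : List S.Sentence :=
  exclusionAxiom c :: (arithmeticAxioms ++ codeAxioms c)

theorem forall_mem_axiomsOf {c : Code} {p : S.Sentence → Prop} :
    (∀ γ ∈ axiomsOf c, p γ) ↔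
      p (exclusionAxiom c) ∧ (∀ γ ∈ arithmeticAxioms, p γ) ∧ ∀ γ ∈ codeAxioms c, p γ := by
  rw [axiomsOf, List.forall_mem_cons, List.forall_mem_append]

/-- The sentence saying that `φ` holds if all the sentences in `Γ` hold. -/
def impliedBy (Γ : List S.Sentence) (φ : S.Sentence) : S.Sentence :=
  Γ.foldr BoundedFormula.imp φ

theorem realize_impliedBy {M : Type*} [S.Structure M] {Γ : List S.Sentence} {φ : S.Sentence} :
    M ⊨ impliedBy Γ φ ↔ ((∀ γ ∈ Γ, M ⊨ γ) → M ⊨ φ) := by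
  induction Γ with
  | nil => simp [impliedBy]
  | cons γ Γ ih =>
    rw [List.forall_mem_cons, and_imp, ← ih]
    exact Sentence.realize_imp M

theorem identityFree_impliedBy {Γ : List S.Sentence} {φ : S.Sentence}
    (hΓ : ∀ γ ∈ Γ, IdentityFree γ) (hφ : IdentityFree φ) : IdentityFree (impliedBy Γ φ) := by
  induction Γ with
  | nil => exact hφ
  | cons γ Γ ih =>
    rw [List.forall_mem_cons] at hΓ
    exact ⟨hΓ.1, ih hΓ.2⟩

theorem identityFree_axiomsOf (c : Code) : ∀ γ ∈ axiomsOf c, IdentityFree γ :=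
  forall_mem_axiomsOf.2 ⟨identityFree_exclusionAxiom c, identityFree_arithmeticAxioms,
    identityFree_codeAxioms c⟩

theorem realize_impliedBy_valueSentence (M : Type*) [S.Structure M] {c : Code} {n : ℕ}
    (hn : 0 ∈ c.eval n) : M ⊨ impliedBy (axiomsOf c) (valueSentence c n) := by
  refine realize_impliedBy.2 fun hΓ => ?_
  obtain ⟨-, hM, hcM⟩ := forall_mem_axiomsOf.1 hΓ
  exact realize_valueSentence hM hcM hn

theorem realize_impliedBy_falsum {M : Type*} [S.Structure M] {c : Code} {n : ℕ}
    (hn : 1 ∈ c.eval n) (h : M ⊨ impliedBy (axiomsOf c) (valueSentence c n)) :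
    M ⊨ impliedBy (axiomsOf c) .falsum := by
  refine realize_impliedBy.2 fun hΓ => ?_
  obtain ⟨he, hM, hcM⟩ := forall_mem_axiomsOf.1 hΓ
  exact not_realize_valueSentence hM hcM he hn (realize_impliedBy.1 h hΓ)

/-! ### Computability of the instances in `n` -/

section Computability

variable {L : FirstOrder.Language.{u, v}} (E : EffectiveVocabulary L) (ψ : Assignment L)

/-- For a fixed symbol `X` the formula `ψ n X` is fixed and only its variables move, so `ψ` need not
be effective. -/
theorem primrec_formulaCode_atom {n : ℕ} (X : ℕ) {d : ℕ → ℕ} (hd : Primrec d)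
    (x : ∀ a, Fin n → Fin (d a)) (hx : ∀ j, Primrec fun a => (x a j : ℕ)) :
    Primrec fun a => E.formulaCode (substInstance ψ (atom X (x a))) :=
  E.primrec_formulaCode_relabel hd (fun a j => Sum.inr (x a j))
    (fun j => Primrec.nat_add.comp (Primrec.nat_mul.comp (Primrec.const 2) (hx j))
      (Primrec.const 1)) _

/-- A function of two variables defined by recursion on the first, with the second increasing in
the recursive calls, is primitive recursive in the first. -/
theorem primrec_of_increasing_parameter {F : ℕ → ℕ → ℕ} {f : ℕ → ℕ} {g : ℕ → ℕ → ℕ}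
    (hf : Primrec f) (hg : Primrec₂ g) (h₀ : ∀ k, F 0 k = f k)
    (h₁ : ∀ n k, F (n + 1) k = g k (F n (k + 1))) : Primrec fun n => F n 0 := by
  -- The recursion is run from the inside out: it starts at `F 0 N`, and after `j` steps reaches `F
  -- j (N - j)`, ending at `F N 0`.
  have key : ∀ N j, j ≤ N →
      (Nat.rec (f N) (fun j r => g (N - (j + 1)) r) j : ℕ) = F j (N - j) := by
    intro N j hj
    induction j with
    | zero => exact (h₀ N).symm
    | succ j ih =>
      rw [h₁, show N - (j + 1) + 1 = N - j by omega, ← ih (by omega)]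
  have hrec : Primrec₂ fun N j : ℕ => (Nat.rec (f N) (fun j r => g (N - (j + 1)) r) j : ℕ) :=
    Primrec.nat_rec hf (g := fun N p => g (N - (p.1 + 1)) p.2)
      (hg.comp (Primrec.nat_sub.comp Primrec.fst
        (Primrec.succ.comp (Primrec.fst.comp Primrec.snd))) (Primrec.snd.comp Primrec.snd))
  refine (hrec.comp Primrec.id Primrec.id).of_eq fun N => ?_
  rw [id, key N N le_rfl, Nat.sub_self]

theorem primrec_formulaCode_valueSentence (c : Code) :
    Primrec fun n => E.formulaCode (substInstance ψ (valueSentence c n)) := by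
  have hk : ∀ i, Primrec fun k : ℕ => k + i := fun i =>
    Primrec.nat_add.comp Primrec.id (Primrec.const i)
  have hpair : ∀ (X : ℕ), Primrec fun k => E.formulaCode (substInstance ψ
      (atom X ![(Fin.last k).castSucc, Fin.last (k + 1)])) := fun X =>
    primrec_formulaCode_atom E ψ X (hk 2) (fun k => ![(Fin.last k).castSucc, Fin.last (k + 1)])
      (Fin.forall_fin_two.2 ⟨Primrec.id, hk 1⟩)
  have hone : Primrec fun k => E.formulaCode (substInstance ψ (atom 0 ![Fin.last (k + 1)])) :=
    primrec_formulaCode_atom E ψ 0 (hk 2) (fun k => ![Fin.last (k + 1)])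
      (Fin.forall_fin_one.2 (hk 1))
  have h := primrec_of_increasing_parameter
    (F := fun n k => E.formulaCode (substInstance ψ (valueAfter c n k)))
    (Primrec₂.natPair.comp (Primrec.const 4) (Primrec₂.natPair.comp (Primrec.const 3)
      (Primrec₂.natPair.comp hone (hpair (Encodable.encode c + 1)))))
    (Primrec₂.natPair.comp (Primrec.const 4) (Primrec₂.natPair.comp (Primrec.const 3)
      (Primrec₂.natPair.comp ((hpair 0).comp Primrec.fst) Primrec.snd))).to₂
    (fun _ => rfl) (fun _ _ => rfl)
  exact Primrec₂.natPair.comp (Primrec.const 4) (Primrec₂.natPair.comp (Primrec.const 3)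
    (Primrec₂.natPair.comp (Primrec.const (E.formulaCode (substInstance ψ (zeroAt (0 : Fin 1))))) h))

theorem primrec_formulaCode_impliedBy (Γ : List S.Sentence) {φ : ℕ → S.Sentence}
    (hφ : Primrec fun n => E.formulaCode (substInstance ψ (φ n))) :
    Primrec fun n => E.formulaCode (substInstance ψ (impliedBy Γ (φ n))) := by
  induction Γ with
  | nil => exact hφ
  | cons γ Γ ih =>
    exact Primrec₂.natPair.comp (Primrec.const 3)
      (Primrec₂.natPair.comp (Primrec.const (E.formulaCode (substInstance ψ γ))) ih)

theorem computablePred_substInstance_mem {T : Set L.Sentence} (hT : E.IsDecidable T) (c : Code) :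
    ComputablePred fun n =>
      substInstance ψ (impliedBy (axiomsOf c) (valueSentence c n)) ∈ T := by
  have hf : Computable fun n =>
      E.formulaCode (substInstance ψ (impliedBy (axiomsOf c) (valueSentence c n))) :=
    (primrec_formulaCode_impliedBy E ψ (axiomsOf c)
      (primrec_formulaCode_valueSentence E ψ c)).to_comp
  have h := ComputablePred.computable_of_manyOneReducible (ManyOneReducible.mk _ hf) hT
  exact h.of_eq fun n => E.mem_iff_exists_formulaCode

end Computability

/-- There is a code whose sets of arguments with values zero and one are recursively
inseparable. -/
theorem exists_inseparable_code : ∃ c : Code, ∀ D : ℕ → Prop, ComputablePred D →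
    (∀ n, 0 ∈ c.eval n → D n) → ∃ n, 1 ∈ c.eval n ∧ D n := by
  -- `c` is the diagonal function: at `n` it runs the `n`-th code on `n`.
  obtain ⟨c, hc⟩ := Code.exists_code.1 (Partrec.nat_iff.1
    (Code.eval_part.comp (Computable.ofNat Code) Computable.id))
  refine ⟨c, fun D hD h₀ => ?_⟩
  obtain ⟨f, hf, rfl⟩ := ComputablePred.computable_iff.1 hD
  -- `d` computes the characteristic function of `D`, so at its own number `c` takes the value 1 or
  -- 0 according to membership in `D`. The value 0 would force membership by `h₀`, a contradiction.
  obtain ⟨d, hd⟩ := Code.exists_code.1 (Partrec.nat_iff.1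
    (Computable.cond hf (Computable.const 1) (Computable.const 0)).partrec)
  have key : c.eval (Encodable.encode d) =
      Part.some (cond (f (Encodable.encode d)) 1 0) := by
    rw [hc]
    simp [hd]
  refine ⟨Encodable.encode d, ?_⟩
  cases hfd : f (Encodable.encode d)
  · rw [hfd] at key
    have := h₀ (Encodable.encode d) (key ▸ Part.mem_some 0)
    simp [hfd] at this
  · rw [hfd] at key
    exact ⟨key ▸ Part.mem_some 1, by simp [hfd]⟩

theorem impliedBy_axiomsOf_falsum_notMem_validSentences (c : Code) :
    impliedBy (axiomsOf c) .falsum ∉ validSentences := by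
  intro h
  let := standardStructure
  have hℕ : ℕ ⊨ impliedBy (axiomsOf c) .falsum := h.2.realize_sentence ℕ
  exact realize_impliedBy.1 hℕ (forall_mem_axiomsOf.2
    ⟨realize_exclusionAxiom_standard c, realize_arithmeticAxioms_standard,
      realize_codeAxioms_standard c⟩)

end Separation

end TheoryValidities

open TheoryValidities in
/-- The validities of first-order logic form a proper subset of the validities of any decidable
theory. -/
theorem mainTheorem10 {L : FirstOrder.Language.{u, v}}
    (E : TheoryValidities.EffectiveVocabulary L) (identity : Bool) (T : Set L.Sentence)
    (hT : TheoryValidities.IsTheory identity T) (hdec : E.IsDecidable T) :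
    TheoryValidities.validSentences ⊂ TheoryValidities.validities identity T := by
  refine (Set.ssubset_iff_of_subset (validSentences_subset_validities hT)).2 ?_
  obtain ⟨c, hc⟩ := exists_inseparable_code
  refine ⟨impliedBy (axiomsOf c) .falsum,
    ⟨identityFree_impliedBy (identityFree_axiomsOf c) trivial, fun ψ hψ => ?_⟩,
    impliedBy_axiomsOf_falsum_notMem_validSentences c⟩
  -- The decidable set, and hence `n`, depends on `ψ`; no uniformity is needed, since `impliedBy
  -- (axiomsOf c) .falsum` does not mention `n`.
  obtain ⟨n, hn, hmem⟩ := hc _ (computablePred_substInstance_mem E ψ hdec c) fun n hn =>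
    hT.substInstance_mem hψ
      (identityFree_impliedBy (identityFree_axiomsOf c) (identityFree_valueSentence c n))
      fun M _ _ _ => @realize_impliedBy_valueSentence M (inducedStructure ψ M) _ _ hn
  exact hT.substInstance_mem hψ
    (identityFree_impliedBy (identityFree_axiomsOf c) trivial) fun M _ _ hMT =>
      @realize_impliedBy_falsum M (inducedStructure ψ M) _ _ hn
        (realize_of_substInstance_mem hmem hMT)
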